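/- Let $d\ge 1$, let $\Omega=\prod_{j=1}^d(a_j,b_j)\subset\mathbb R^d$ with $a_j<b_j$, let $\varepsilon,\kappa,\beta>0$, and let $f:\mathbb R\to\mathbb R$ be continuously differentiable with $f(\beta)\le 0\le f(-\beta)$ and $\kappa\ge\max_{|\xi|\le\beta}|f'(\xi)|$. Put $\mathcal N(v)=f(v)+\kappa v$ and $\mathcal L_\kappa=\varepsilon^2\Delta-\kappa$, where $\Delta$ is the Laplacian on $\Omega$ with periodic boundary conditions. Functions of $\mathcal L_\kappa$ are understood through the expansion in the periodic exponentials $e_q(x)=\exp\bigl(2\pi i\sum_j q_j(x_j-a_j)/(b_j-a_j)\bigr)$, $q\in\mathbb Z^d$, which are eigenfunctions of $\mathcal L_\kappa$ with eigenvalues $\lambda_q=-\varepsilon^2\sum_j\bigl(2\pi q_j/(b_j-a_j)\bigr)^2-\kappa$: $$\varphi(\mathcal L_\kappa)v=\sum_{q\in\mathbb Z^d}\varphi(\lambda_q)\,\hat v_q\,e_q\ \text{ in } L^2(\Omega),\qquad \hat v_q=\frac1{|\Omega|}\int_\Omega \overline{e_q}\,v\,\mathrm dx .$$ Let $k\ge1$.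 For each level $2\le j\le k$ fix a quadrature rule on $[0,1]$ with nodes $c_{j,1},\dots,c_{j,m_j}$ and weights $b_{j,1},\dots,b_{j,m_j}$, $m_j\ge1$, which is either the Gauss–Legendre rule (distinct nodes in $(0,1)$, exact for polynomials of degree at most $2m_j-1$) or the left Gauss–Radau rule (distinct nodes, one equal to $0$ and the others in $(0,1)$, exact for polynomials of degree at most $2m_j-2$). For $s\ge 0$ the corresponding rule on $[0,s]$ has nodes $s\,c_{j,i}$ and weights $s\,b_{j,i}$. Given $\tau>0$ and $u^0\in L^\infty(\Omega)$, the $k$-th order iterative exponential integrator EI$k$ is defined by $u^{n+1}=w^{[k],n}(\tau)$ for $n\ge0$, where for $s\ge 0$ $$w^{[1],n}(s)=e^{s\mathcal L_\kappa}u^n+(e^{s\mathcal L_\kappa}-\mathcal I)\mathcal L_\kappa^{-1}\mathcal N(u^n),$$ $$w^{[j],n}(s)=e^{s\mathcal L_\kappa}u^n+\sum_{i=1}^{m_j}s\,b_{j,i}\,e^{(s-s c_{j,i})\mathcal L_\kappa}\mathcal N\bigl(w^{[j-1],n}(s c_{j,i})\bigr),\qquad 2\le j\le k .$$ If $\|u^0\|_{L^\infty(\Omega)}\le\beta$,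 then for every $\tau>0$ and every $n\ge 0$ one has $u^n\in L^\infty(\Omega)$ and $\|u^n\|_{L^\infty(\Omega)}\le\beta$. -/

import Mathlib

open MeasureTheory
open scoped ENNReal

namespace AllenCahn

/-- The open box `∏ j, (a j, b j)`, the cell on which periodic boundary conditions are imposed. -/
def box {d : ℕ} (a b : Fin d → ℝ) : Set (Fin d → ℝ) :=
  Set.univ.pi fun j => Set.Ioo (a j) (b j)

/-- Lebesgue measure on the box. -/
noncomputable def boxMeasure {d : ℕ} (a b : Fin d → ℝ) : Measure (Fin d → ℝ) :=
  volume.restrict (box a b)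

/-- The periodic exponential `e_k(x) = exp (2πi ∑ j, k_j (x_j - a_j) / (b_j - a_j))`. -/
noncomputable def expMode {d : ℕ} (a b : Fin d → ℝ) (k : Fin d → ℤ) (x : Fin d → ℝ) : ℂ :=
  Complex.exp ((2 * Real.pi * ∑ j, (k j : ℝ) * (x j - a j) / (b j - a j) : ℝ) * Complex.I)

/-- The Fourier coefficient `|Ω|⁻¹ ∫_Ω conj(e_k) v` of a function on the box. -/
noncomputable def coeff {d : ℕ} (a b : Fin d → ℝ) (v : (Fin d → ℝ) → ℝ) (k : Fin d → ℤ) : ℂ :=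
  ((∏ j, (b j - a j))⁻¹ : ℝ) *
    ∫ x, (starRingEnd ℂ) (expMode a b k x) * (v x : ℂ) ∂(boxMeasure a b)

/-- The differential operator `L_κ g = ε² Δ g - κ g`, applied to a smooth function. -/
noncomputable def stabOp {d : ℕ} (ε κ : ℝ) (g : (Fin d → ℝ) → ℂ) (x : Fin d → ℝ) : ℂ :=
  ε ^ 2 * ∑ j, iteratedDeriv 2 (fun t : ℝ => g (Function.update x j t)) (x j) - κ * g x

/-- The eigenvalue `-ε² |2πk/ℓ|² - κ` of `L_κ` at the eigenfunction `e_k`, with `ℓ = b - a`. -/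
noncomputable def eigenvalue {d : ℕ} (a b : Fin d → ℝ) (ε κ : ℝ) (k : Fin d → ℤ) : ℝ :=
  -(ε ^ 2 * ∑ j, (2 * Real.pi * k j / (b j - a j)) ^ 2) - κ

/-- The periodic exponentials are eigenfunctions of `L_κ`. -/
theorem stabOp_expMode {d : ℕ} (a b : Fin d → ℝ) (ε κ : ℝ) (k : Fin d → ℤ) (x : Fin d → ℝ) :
    stabOp ε κ (expMode a b k) x = eigenvalue a b ε κ k * expMode a b k x := by
  have key : ∀ j, iteratedDeriv 2 (fun t : ℝ => expMode a b k (Function.update x j t)) (x j)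
      = -((2 * Real.pi * k j / (b j - a j)) ^ 2 : ℝ) * expMode a b k x := by
    intro j
    set c : ℂ := ((2 * Real.pi * k j / (b j - a j) : ℝ) : ℂ) * Complex.I with hc
    have h1 : (fun t : ℝ => expMode a b k (Function.update x j t))
        = fun t : ℝ => expMode a b k x * Complex.exp (c * ((t : ℂ) - (x j : ℂ))) := by
      funext t
      have hs : ∑ i, (k i : ℝ) * (Function.update x j t i - a i) / (b i - a i)
          = ∑ i, (k i : ℝ) * (x i - a i) / (b i - a i) + k j * (t - x j) / (b j - a j) := by
        rw [← Finset.add_sum_erase _ _ (Finset.mem_univ j),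
          ← Finset.add_sum_erase (a := j) (f := fun i => (k i : ℝ) * (x i - a i) / (b i - a i))
            _ (Finset.mem_univ j)]
        have : ∑ i ∈ Finset.univ.erase j, (k i : ℝ) * (Function.update x j t i - a i) / (b i - a i)
            = ∑ i ∈ Finset.univ.erase j, (k i : ℝ) * (x i - a i) / (b i - a i) := by
          refine Finset.sum_congr rfl fun i hi => ?_
          rw [Function.update_of_ne (Finset.ne_of_mem_erase hi)]
        rw [this, Function.update_self]
        ring
      unfold expMode
      rw [hs, ← Complex.exp_add, hc]
      congr 1
      push_cast
      ring
    have hd : ∀ (A : ℂ), deriv (fun t : ℝ => A * Complex.exp (c * ((t : ℂ) - (x j : ℂ))))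
        = fun t : ℝ => (A * c) * Complex.exp (c * ((t : ℂ) - (x j : ℂ))) := by
      intro A
      funext t
      have h := (((Complex.ofRealCLM.hasDerivAt (x := t)).sub_const (x j : ℂ)).const_mul c).cexp
      have h' := (h.const_mul A).deriv
      simp only [Complex.ofRealCLM_apply, Complex.ofReal_one, mul_one] at h'
      rw [h']
      ring
    rw [h1, iteratedDeriv_succ, iteratedDeriv_one, hd, hd]
    simp only [sub_self, mul_zero, Complex.exp_zero, mul_one, hc]
    push_cast
    linear_combination (expMode a b k x * (2 * Real.pi * k j / (b j - a j)) ^ 2) * Complex.I_sq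
  unfold stabOp eigenvalue
  rw [Finset.sum_congr rfl fun j _ => key j, ← Finset.sum_mul]
  push_cast
  rw [Finset.sum_neg_distrib]
  ring

theorem memLp_expMode {d : ℕ} (a b : Fin d → ℝ) (k : Fin d → ℤ) :
    MemLp (expMode a b k) 2 (boxMeasure a b) := by
  have : IsFiniteMeasure (boxMeasure a b) := by
    refine ⟨?_⟩
    have h : volume (box a b) < ∞ := by
      unfold box
      rw [Real.volume_pi_Ioo]
      exact ENNReal.prod_lt_top fun i _ => ENNReal.ofReal_lt_top
    simpa [boxMeasure] using h
  refine MemLp.of_bound (C := 1) ?_ (Filter.Eventually.of_forall fun x => ?_)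
  · refine Continuous.aestronglyMeasurable ?_
    unfold expMode
    fun_prop
  · unfold expMode
    rw [Complex.norm_exp_ofReal_mul_I]

/-- The operator `φ(L_κ)` on `L²` of the box, where `L_κ = ε² Δ - κ` is taken with periodic boundary
conditions: `φ(L_κ) v = ∑ k, φ(λ_k) v̂(k) e_k`, with convergence in `L²` (unconditional if `φ` is
bounded on the spectrum and `v ∈ L²`). For real `v` the terms at `k` and `-k` are conjugate, so the
sum is real; the result is a representative of it. -/
noncomputable def opFun {d : ℕ} (a b : Fin d → ℝ) (ε κ : ℝ) (φ : ℝ → ℝ) (v : (Fin d → ℝ) → ℝ) :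
    (Fin d → ℝ) → ℝ := fun x =>
  Complex.re ((∑' k : Fin d → ℤ, ((φ (eigenvalue a b ε κ k) : ℂ) * coeff a b v k) •
    (memLp_expMode a b k).toLp (expMode a b k) : Lp ℂ 2 (boxMeasure a b)) x)

/-- The semigroup operator `e^{t L_κ}`. -/
noncomputable def expL {d : ℕ} (a b : Fin d → ℝ) (ε κ t : ℝ) :
    ((Fin d → ℝ) → ℝ) → (Fin d → ℝ) → ℝ :=
  opFun a b ε κ fun z => Real.exp (t * z)

/-- The inverse operator `L_κ⁻¹` (for `κ > 0` all eigenvalues are at most `-κ < 0`). -/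
noncomputable def invL {d : ℕ} (a b : Fin d → ℝ) (ε κ : ℝ) :
    ((Fin d → ℝ) → ℝ) → (Fin d → ℝ) → ℝ :=
  opFun a b ε κ fun z => z⁻¹

/-- The nonlinear operator `N(v) = f(v) + κ v`. -/
def nonlin {d : ℕ} (κ : ℝ) (f : ℝ → ℝ) (v : (Fin d → ℝ) → ℝ) : (Fin d → ℝ) → ℝ :=
  fun x => f (v x) + κ * v x

/-- A quadrature rule `∑ i, weight i * g (node i)`, with `m` nodes, for `∫_0^1 g`. It is transported
to the interval `[0, s]` by the affine change of variables, with nodes `s * node i` and weights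
`s * weight i`. -/
structure QuadRule where
  m : ℕ
  node : Fin m → ℝ
  weight : Fin m → ℝ

/-- The Gauss–Legendre rule: `m ≥ 1` interior nodes, exact for polynomials of degree at most
`2m - 1`. -/
def QuadRule.IsGaussLegendre (R : QuadRule) : Prop :=
  0 < R.m ∧ Function.Injective R.node ∧ (∀ i, R.node i ∈ Set.Ioo (0 : ℝ) 1) ∧
    ∀ p : Polynomial ℝ, p.natDegree + 1 ≤ 2 * R.m →
      ∑ i, R.weight i * p.eval (R.node i) = ∫ x in (0 : ℝ)..1, p.eval x

/-- The left Gauss–Radau rule: `m ≥ 1` nodes, one at the left end point and the others interior,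
exact for polynomials of degree at most `2m - 2`. -/
def QuadRule.IsLeftGaussRadau (R : QuadRule) : Prop :=
  (∃ i, R.node i = 0) ∧ Function.Injective R.node ∧ (∀ i, R.node i ∈ Set.Ico (0 : ℝ) 1) ∧
    ∀ p : Polynomial ℝ, p.natDegree + 2 ≤ 2 * R.m →
      ∑ i, R.weight i * p.eval (R.node i) = ∫ x in (0 : ℝ)..1, p.eval x

/-- The iterated approximations `w^{[j]}(s)` started at `u`, with the rule `Q j` at level `j ≥ 2`.
The value at `j = 0` is not part of the scheme. -/
noncomputable def stage {d : ℕ} (a b : Fin d → ℝ) (ε κ : ℝ) (f : ℝ → ℝ) (Q : ℕ → QuadRule)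
    (u : (Fin d → ℝ) → ℝ) : ℕ → ℝ → (Fin d → ℝ) → ℝ
  | 0, _ => u
  | 1, s => expL a b ε κ s u +
      (expL a b ε κ s (invL a b ε κ (nonlin κ f u)) - invL a b ε κ (nonlin κ f u))
  | j + 2, s => expL a b ε κ s u +
      ∑ i : Fin (Q (j + 2)).m, (s * (Q (j + 2)).weight i) •
        expL a b ε κ (s - s * (Q (j + 2)).node i)
          (nonlin κ f (stage a b ε κ f Q u (j + 1) (s * (Q (j + 2)).node i)))

/-- The numerical solution `u^n` of the `k`-th order exponential integrator with time step `τ`: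
`u^{n+1} = w^{[k],n}(τ)`. -/
noncomputable def solution {d : ℕ} (a b : Fin d → ℝ) (ε κ : ℝ) (f : ℝ → ℝ) (Q : ℕ → QuadRule)
    (k : ℕ) (τ : ℝ) (u₀ : (Fin d → ℝ) → ℝ) : ℕ → (Fin d → ℝ) → ℝ
  | 0 => u₀
  | n + 1 => stage a b ε κ f Q (solution a b ε κ f Q k τ u₀ n) k τ

end AllenCahn

/-!
The operator `e^{t L_κ}` is `e^{-κ t}` times the periodic heat semigroup, and the heat semigroup is
a Gaussian average of translations of the torus: on the exponential `e_k`, translation by `y` acts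
as multiplication by a character value, and averaging these values over a Gaussian gives the
eigenvalue of `e^{t ε² Δ}` by the formula for its characteristic function. Translations preserve
every ball `{v | |v| ≤ M a.e.}`; such balls are closed and convex in `L²`, so averages preserve them too
(`SupMultiplier.integral`). Hence `e^{t L_κ}` maps the ball of radius `M` to the ball of radius
`e^{-κ t} M` (`EssBdd.expL`), and `(e^{s L_κ} - 1) L_κ⁻¹ = ∫ t in 0..s, e^{t L_κ}` maps it to the
ball of radius `(1 - e^{-κ s}) / κ * M` (`EssBdd.expL_invL_sub_invL`). The argument stays on the Fourier
side, with diagonal operators in the Hilbert basis of normalized exponentials; the completeness of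
this basis and the translations come from the torus via the rescaling `toTorus`.

The condition `|f'| ≤ κ` makes `ξ ↦ f ξ + κ ξ` monotone on `[-β, β]`, so that `|v| ≤ β` implies
`|N(v)| ≤ κ β` (`abs_add_mul_le`). The first iterate is then bounded by
`e^{-κ s} β + (1 - e^{-κ s}) β = β`. For the later iterates the integral is replaced by a quadrature
sum, and one needs nonnegative weights (`QuadRule.weight_nonneg`) and that the rule underestimates
the integral of `x ↦ e^{κ s x}` (`QuadRule.sum_exp_le_integral`). By Taylor expansion the latter
reduces to polynomials `p` with nonnegative coefficients. Divide `p` by the polynomial `ω` with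
double zeros at the nodes, except for a simple zero at the node `0` of a Radau rule. The quotient
has nonnegative coefficients, because the nodes are nonnegative; as `ω ≥ 0` on `[0, 1]`, the
remainder, which the rule integrates exactly, agrees with `p` at the nodes and lies below it on
`[0, 1]`.
-/

namespace AllenCahn

/-! ### Quadrature rules of Gauss type -/

/-- Dividing a polynomial with nonnegative coefficients by a product of factors `X - c`, `c ≥ 0`,
gives a quotient with nonnegative coefficients. -/
theorem exists_eq_prod_mul_add (s : Multiset ℝ) (hs : ∀ c ∈ s, 0 ≤ c) (p : Polynomial ℝ)
    (hp : ∀ n, 0 ≤ p.coeff n) :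
    ∃ q r : Polynomial ℝ,
      p = (s.map fun c => Polynomial.X - Polynomial.C c).prod * q + r ∧
        (∀ n, 0 ≤ q.coeff n) ∧ r.degree < s.card := by
  induction s using Multiset.induction_on with
  | empty => exact ⟨p, 0, by simp, hp, by simp⟩
  | cons c t ih =>
    obtain ⟨q, r, h, hq, hr⟩ := ih fun c hc => hs c (Multiset.mem_cons_of_mem hc)
    have hc : 0 ≤ c := hs c (Multiset.mem_cons_self c t)
    refine ⟨q /ₘ (Polynomial.X - Polynomial.C c),
      r + (t.map fun c => Polynomial.X - Polynomial.C c).prod * Polynomial.C (q.eval c),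
      ?_, fun n => ?_, ?_⟩
    · have hmod := Polynomial.modByMonic_add_div q (Polynomial.X - Polynomial.C c)
      rw [Polynomial.modByMonic_X_sub_C_eq_C_eval] at hmod
      rw [Multiset.map_cons, Multiset.prod_cons]
      calc p = (t.map fun c => Polynomial.X - Polynomial.C c).prod * q + r := h
        _ = (t.map fun c => Polynomial.X - Polynomial.C c).prod *
            (Polynomial.C (q.eval c) + (Polynomial.X - Polynomial.C c) *
              (q /ₘ (Polynomial.X - Polynomial.C c))) + r := by rw [hmod]
        _ = _ := by ring
    · rw [Polynomial.coeff_divByMonic_X_sub_C]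
      exact Finset.sum_nonneg fun i _ => mul_nonneg (pow_nonneg hc _) (hq i)
    · rw [Multiset.card_cons]
      refine lt_of_le_of_lt (Polynomial.degree_add_le _ _) (max_lt ?_ ?_)
      · exact hr.trans (by exact_mod_cast Nat.lt_succ_self _)
      · refine lt_of_le_of_lt (Polynomial.degree_mul_le _ _) ?_
        refine lt_of_le_of_lt (add_le_add (Polynomial.degree_multiset_prod_le _)
          Polynomial.degree_C_le) ?_
        simp only [Multiset.map_map, Function.comp_def, Polynomial.degree_X_sub_C,
          Multiset.map_const', Multiset.sum_replicate, add_zero, nsmul_eq_mul, mul_one]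
        exact_mod_cast Nat.lt_succ_self _

/-- If the quadrature error vanishes on polynomials of degree less than `N` and the nodes, counted
with multiplicity, are the zeros of a polynomial of degree `N` that is nonnegative on `[0, 1]`, then
the rule underestimates the integral of every polynomial with nonnegative coefficients. -/
theorem QuadRule.sum_eval_le_integral (R : QuadRule) (s : Multiset ℝ) (hs : ∀ c ∈ s, 0 ≤ c)
    (hnode : ∀ i, R.node i ∈ s)
    (hpos : ∀ x ∈ Set.Icc (0 : ℝ) 1, 0 ≤ (s.map fun c => x - c).prod)
    (hex : ∀ p : Polynomial ℝ, p.degree < s.card →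
      ∑ i, R.weight i * p.eval (R.node i) = ∫ x in (0 : ℝ)..1, p.eval x)
    (p : Polynomial ℝ) (hp : ∀ n, 0 ≤ p.coeff n) :
    ∑ i, R.weight i * p.eval (R.node i) ≤ ∫ x in (0 : ℝ)..1, p.eval x := by
  obtain ⟨q, r, h, hq, hr⟩ := exists_eq_prod_mul_add s hs p hp
  have heval : ∀ x, p.eval x = (s.map fun c => x - c).prod * q.eval x + r.eval x := by
    intro x
    rw [h, Polynomial.eval_add, Polynomial.eval_mul, Polynomial.eval_multiset_prod,
      Multiset.map_map]
    simp
  have h1 : ∀ i, p.eval (R.node i) = r.eval (R.node i) := by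
    intro i
    rw [heval, Multiset.prod_eq_zero, zero_mul, zero_add]
    exact Multiset.mem_map.2 ⟨R.node i, hnode i, sub_self _⟩
  simp only [h1]
  rw [hex r hr]
  refine intervalIntegral.integral_mono_on zero_le_one
    (r.continuous.intervalIntegrable _ _) (p.continuous.intervalIntegrable _ _) fun x hx => ?_
  rw [heval]
  have hqx : 0 ≤ q.eval x := by
    rw [Polynomial.eval_eq_sum_range]
    exact Finset.sum_nonneg fun i _ => mul_nonneg (hq i) (pow_nonneg hx.1 _)
  linarith [mul_nonneg (hpos x hx) hqx]

/-- A rule with `m` distinct nodes that is exact up to degree `2m - 2` has nonnegative weights: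
test it on the square of the Lagrange polynomial of a node. -/
theorem QuadRule.weight_nonneg (R : QuadRule) (hinj : Function.Injective R.node)
    (hex : ∀ p : Polynomial ℝ, p.natDegree + 2 ≤ 2 * R.m →
      ∑ i, R.weight i * p.eval (R.node i) = ∫ x in (0 : ℝ)..1, p.eval x) (i : Fin R.m) :
    0 ≤ R.weight i := by
  set l : Polynomial ℝ :=
    ∏ k ∈ Finset.univ.erase i, (Polynomial.X - Polynomial.C (R.node k)) with hl
  have hdeg : l.natDegree = R.m - 1 := by
    rw [hl, Polynomial.natDegree_finsetProd_X_sub_C_eq_card]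
    simp
  have hm : 1 ≤ R.m := Nat.one_le_iff_ne_zero.2 fun h => (Fin.cast h i).elim0
  have h := hex (l ^ 2) (by
    have := Polynomial.natDegree_pow_le (p := l) (n := 2)
    omega)
  rw [Finset.sum_eq_single i] at h
  · have hpos : 0 < (l ^ 2).eval (R.node i) := by
      rw [Polynomial.eval_pow]
      refine sq_pos_iff.2 ?_
      rw [hl, Polynomial.eval_prod]
      refine Finset.prod_ne_zero_iff.2 fun k hk => ?_
      simp only [Polynomial.eval_sub, Polynomial.eval_X, Polynomial.eval_C]
      exact sub_ne_zero.2 fun e => Finset.ne_of_mem_erase hk (hinj e).symm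
    have hint : 0 ≤ ∫ x in (0 : ℝ)..1, (l ^ 2).eval x :=
      intervalIntegral.integral_nonneg zero_le_one fun x _ => by
        rw [Polynomial.eval_pow]; positivity
    rw [← h] at hint
    exact nonneg_of_mul_nonneg_left hint hpos
  · intro k _ hk
    rw [hl, Polynomial.eval_pow, Polynomial.eval_prod,
      Finset.prod_eq_zero (Finset.mem_erase.2 ⟨hk, Finset.mem_univ k⟩) (by simp)]
    simp
  · simp

/-- The Gauss–Legendre and left Gauss–Radau rules underestimate the integral of every polynomial
with nonnegative coefficients. -/
theorem QuadRule.sum_eval_le_integral_of_gauss (R : QuadRule)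
    (hR : R.IsGaussLegendre ∨ R.IsLeftGaussRadau) (p : Polynomial ℝ) (hp : ∀ n, 0 ≤ p.coeff n) :
    ∑ i, R.weight i * p.eval (R.node i) ≤ ∫ x in (0 : ℝ)..1, p.eval x := by
  rcases hR with ⟨hm, -, hnode, hex⟩ | ⟨⟨i₀, hi₀⟩, -, hnode, hex⟩
  · refine R.sum_eval_le_integral
      (Finset.univ.val.map R.node + Finset.univ.val.map R.node) ?_ ?_ ?_ ?_ p hp
    · simp only [Multiset.mem_add, or_self, Multiset.mem_map]
      rintro _ ⟨i, -, rfl⟩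
      exact (hnode i).1.le
    · intro i
      simp
    · intro x _
      rw [Multiset.map_add, Multiset.prod_add]
      exact mul_self_nonneg _
    · intro r hr
      refine hex r ?_
      simp only [Multiset.card_add, Multiset.card_map, Finset.card_val, Finset.card_univ,
        Fintype.card_fin] at hr
      rcases eq_or_ne r 0 with rfl | h0
      · simp; omega
      · have := (Polynomial.natDegree_lt_iff_degree_lt h0).2 hr
        omega
  · refine R.sum_eval_le_integral
      (Finset.univ.val.map R.node + (Finset.univ.erase i₀).val.map R.node) ?_ ?_ ?_ ?_ p hp
    · simp only [Multiset.mem_add, Multiset.mem_map]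
      rintro _ (⟨i, -, rfl⟩ | ⟨i, -, rfl⟩) <;> exact (hnode i).1
    · intro i
      simp
    · intro x hx
      rw [Multiset.map_add, Multiset.prod_add, Multiset.map_map, Multiset.map_map]
      change 0 ≤ (∏ i, (x - R.node i)) * ∏ i ∈ Finset.univ.erase i₀, (x - R.node i)
      rw [← Finset.mul_prod_erase _ _ (Finset.mem_univ i₀), hi₀, mul_assoc, sub_zero]
      exact mul_nonneg hx.1 (mul_self_nonneg _)
    · intro r hr
      refine hex r ?_
      have hm : 1 ≤ R.m := Nat.one_le_iff_ne_zero.2 fun h => (Fin.cast h i₀).elim0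
      simp only [Multiset.card_add, Multiset.card_map, Finset.card_val, Finset.card_univ,
        Fintype.card_fin, Finset.card_erase_of_mem (Finset.mem_univ i₀)] at hr
      rcases eq_or_ne r 0 with rfl | h0
      · simp; omega
      · have := (Polynomial.natDegree_lt_iff_degree_lt h0).2 hr
        omega

theorem QuadRule.weight_nonneg_of_gauss (R : QuadRule)
    (hR : R.IsGaussLegendre ∨ R.IsLeftGaussRadau) (i : Fin R.m) : 0 ≤ R.weight i := by
  rcases hR with ⟨-, hinj, -, hex⟩ | ⟨-, hinj, -, hex⟩
  · exact R.weight_nonneg hinj (fun p hp => hex p (by omega)) i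
  · exact R.weight_nonneg hinj hex i

theorem QuadRule.node_mem_of_gauss (R : QuadRule)
    (hR : R.IsGaussLegendre ∨ R.IsLeftGaussRadau) (i : Fin R.m) : R.node i ∈ Set.Icc (0 : ℝ) 1 := by
  rcases hR with ⟨-, -, h, -⟩ | ⟨-, -, h, -⟩
  · exact Set.Ioo_subset_Icc_self (h i)
  · exact Set.Ico_subset_Icc_self (h i)

theorem QuadRule.sum_exp_le_integral (R : QuadRule)
    (hR : R.IsGaussLegendre ∨ R.IsLeftGaussRadau) {z : ℝ} (hz : 0 ≤ z) :
    ∑ i, R.weight i * Real.exp (z * R.node i) ≤ ∫ x in (0 : ℝ)..1, Real.exp (z * x) := by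
  -- The Taylor polynomials of `x ↦ exp (z x)` have nonnegative coefficients.
  set P : ℕ → Polynomial ℝ := fun N =>
    ∑ n ∈ Finset.range N, Polynomial.monomial n (z ^ n / n.factorial) with hP
  have hev : ∀ N x, (P N).eval x = ∑ n ∈ Finset.range N, (z * x) ^ n / n.factorial := by
    intro N x
    simp only [hP, Polynomial.eval_finsetSum, Polynomial.eval_monomial]
    refine Finset.sum_congr rfl fun n _ => ?_
    rw [mul_pow]; ring
  have hlim : ∀ x, Filter.Tendsto (fun N => (P N).eval x) Filter.atTop
      (nhds (Real.exp (z * x))) := by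
    intro x
    simp only [hev]
    rw [Real.exp_eq_exp_ℝ]
    exact (NormedSpace.expSeries_div_hasSum_exp (z * x)).tendsto_sum_nat
  refine le_of_tendsto (tendsto_finsetSum _ fun i _ => (hlim (R.node i)).const_mul (R.weight i))
    (Filter.Eventually.of_forall fun N => ?_)
  refine (R.sum_eval_le_integral_of_gauss hR (P N) fun n => ?_).trans ?_
  · simp only [hP, Polynomial.finsetSum_coeff, Polynomial.coeff_monomial]
    refine Finset.sum_nonneg fun k _ => ?_
    split_ifs <;> positivity
  · refine intervalIntegral.integral_mono_on zero_le_one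
      ((P N).continuous.intervalIntegrable _ _)
      (Continuous.intervalIntegrable (by fun_prop) _ _) fun x hx => ?_
    rw [hev]
    exact Real.sum_le_exp_of_nonneg (mul_nonneg hz hx.1) N

/-- The discrete Duhamel sum of a constant source stays below the exact integral
`∫ r in 0..s, κ e^{-κ (s - r)} dr = 1 - e^{-κ s}`. -/
theorem QuadRule.sum_weight_exp_le (R : QuadRule)
    (hR : R.IsGaussLegendre ∨ R.IsLeftGaussRadau) {κ s : ℝ} (hκ : 0 < κ) (hs : 0 ≤ s) :
    ∑ i, s * R.weight i * (Real.exp (-(κ * (s - s * R.node i))) * κ) ≤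
      1 - Real.exp (-(κ * s)) := by
  have h := R.sum_exp_le_integral hR (mul_nonneg hκ.le hs)
  have h1 : (κ * s) * ∫ x in (0 : ℝ)..1, Real.exp (κ * s * x) = Real.exp (κ * s) - 1 := by
    rw [intervalIntegral.mul_integral_comp_mul_left (f := Real.exp)]
    simp
  calc ∑ i, s * R.weight i * (Real.exp (-(κ * (s - s * R.node i))) * κ)
      = Real.exp (-(κ * s)) * (κ * s) * ∑ i, R.weight i * Real.exp (κ * s * R.node i) := by
        rw [Finset.mul_sum]
        refine Finset.sum_congr rfl fun i _ => ?_
        rw [show -(κ * (s - s * R.node i)) = -(κ * s) + κ * s * R.node i by ring, Real.exp_add]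
        ring
    _ ≤ Real.exp (-(κ * s)) * (κ * s) * ∫ x in (0 : ℝ)..1, Real.exp (κ * s * x) := by gcongr
    _ = 1 - Real.exp (-(κ * s)) := by
        rw [mul_assoc, h1, mul_sub, ← Real.exp_add]
        simp

/-! ### The nonlinearity -/

/-- The condition `|f'| ≤ κ` makes `x ↦ f x + κ x` monotone, so its extreme values on `[-β, β]`
are taken at the end points, where the sign conditions on `f` apply. -/
theorem abs_add_mul_le {f : ℝ → ℝ} (hf : ContDiff ℝ 1 f) {κ β : ℝ} (hβ : 0 ≤ β)
    (hfβ : f β ≤ 0) (hfβ' : 0 ≤ f (-β)) (hκf : ∀ ξ ∈ Set.Icc (-β) β, |deriv f ξ| ≤ κ)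
    {x : ℝ} (hx : |x| ≤ β) : |f x + κ * x| ≤ κ * β := by
  have hd : Differentiable ℝ f := hf.differentiable one_ne_zero
  have hmono : MonotoneOn (fun x => f x + κ * x) (Set.Icc (-β) β) := by
    refine monotoneOn_of_deriv_nonneg (convex_Icc _ _)
      (hd.continuous.add (continuous_const.mul continuous_id)).continuousOn
      (hd.add (differentiable_id.const_mul κ)).differentiableOn fun y hy => ?_
    have h : HasDerivAt (fun x => f x + κ * x) (deriv f y + κ * 1) y :=
      (hd y).hasDerivAt.add ((hasDerivAt_id y).const_mul κ)
    rw [h.deriv]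
    have := (abs_le.1 (hκf y (interior_subset hy))).1
    linarith
  have hx' : x ∈ Set.Icc (-β) β := abs_le.1 hx
  have h1 := hmono hx' (Set.right_mem_Icc.2 (by linarith)) hx'.2
  have h2 := hmono (Set.left_mem_Icc.2 (by linarith)) hx' hx'.1
  simp only at h1 h2
  rw [abs_le]
  constructor <;> linarith

/-! ### Multipliers of a Hilbert basis and sup bounds -/

section Multiplier

variable {ι X : Type*} [MeasurableSpace X] {μ : Measure X}

/-- The diagonal operator with symbol `m` in the Hilbert basis `B` of `L²(μ)`. It is meaningful for
bounded `m`, where the series converges. -/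
noncomputable def mulOp (B : HilbertBasis ι ℂ (Lp ℂ 2 μ)) (m : ι → ℂ) (v : Lp ℂ 2 μ) : Lp ℂ 2 μ :=
  ∑' i, (m i * B.repr v i) • B i

variable (B : HilbertBasis ι ℂ (Lp ℂ 2 μ))

theorem memℓp_mul_repr {m : ι → ℂ} {C : ℝ} (hm : ∀ i, ‖m i‖ ≤ C) (v : Lp ℂ 2 μ) :
    Memℓp (fun i => m i * B.repr v i) 2 := by
  refine memℓp_gen ?_
  have h := ((lp.memℓp (B.repr v)).summable (by simp)).mul_left (C ^ 2)
  refine Summable.of_nonneg_of_le (fun i => by positivity) (fun i => ?_) h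
  simp only [ENNReal.toReal_ofNat, Real.rpow_two, norm_mul, mul_pow]
  gcongr
  exact hm i

theorem repr_mulOp {m : ι → ℂ} {C : ℝ} (hm : ∀ i, ‖m i‖ ≤ C) (v : Lp ℂ 2 μ) (i : ι) :
    B.repr (mulOp B m v) i = m i * B.repr v i := by
  have h : mulOp B m v = B.repr.symm ⟨_, memℓp_mul_repr B hm v⟩ :=
    (B.hasSum_repr_symm ⟨_, memℓp_mul_repr B hm v⟩).tsum_eq
  rw [h, LinearIsometryEquiv.apply_symm_apply]

theorem eq_of_repr_eq {v w : Lp ℂ 2 μ} (h : ∀ i, B.repr v i = B.repr w i) : v = w :=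
  B.repr.injective (lp.ext (funext h))

theorem norm_sq_mulOp {m : ι → ℂ} {C : ℝ} (hm : ∀ i, ‖m i‖ ≤ C) (v : Lp ℂ 2 μ) :
    ‖mulOp B m v‖ ^ 2 = ∑' i, ‖m i‖ ^ 2 * ‖B.repr v i‖ ^ 2 := by
  rw [← B.repr.norm_map (mulOp B m v)]
  have h := lp.norm_rpow_eq_tsum (p := 2) (by simp) (B.repr (mulOp B m v))
  simp only [ENNReal.toReal_ofNat, Real.rpow_two] at h
  rw [h]
  refine tsum_congr fun i => ?_
  rw [repr_mulOp B hm, norm_mul, mul_pow]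

theorem mulOp_sub {m m' : ι → ℂ} {C C' : ℝ} (hm : ∀ i, ‖m i‖ ≤ C) (hm' : ∀ i, ‖m' i‖ ≤ C')
    (v : Lp ℂ 2 μ) : mulOp B m v - mulOp B m' v = mulOp B (fun i => m i - m' i) v := by
  refine eq_of_repr_eq B fun i => ?_
  have h : ∀ i, ‖m i - m' i‖ ≤ C + C' := fun i =>
    (norm_sub_le _ _).trans (add_le_add (hm i) (hm' i))
  rw [repr_mulOp B h, map_sub, lp.coeFn_sub, Pi.sub_apply, repr_mulOp B hm, repr_mulOp B hm']
  ring

theorem mulOp_mul {m m' : ι → ℂ} {C C' : ℝ} (hm : ∀ i, ‖m i‖ ≤ C) (hm' : ∀ i, ‖m' i‖ ≤ C')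
    (v : Lp ℂ 2 μ) : mulOp B m (mulOp B m' v) = mulOp B (fun i => m i * m' i) v := by
  refine eq_of_repr_eq B fun i => ?_
  have h : ∀ i, ‖m i * m' i‖ ≤ C * C' := fun i => by
    rw [norm_mul]
    exact mul_le_mul (hm i) (hm' i) (norm_nonneg _) ((norm_nonneg _).trans (hm i))
  rw [repr_mulOp B h, repr_mulOp B hm, repr_mulOp B hm', mul_assoc]

theorem mulOp_const_mul (c : ℂ) {m : ι → ℂ} {C : ℝ} (hm : ∀ i, ‖m i‖ ≤ C) (v : Lp ℂ 2 μ) :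
    mulOp B (fun i => c * m i) v = c • mulOp B m v := by
  refine eq_of_repr_eq B fun i => ?_
  have h : ∀ i, ‖c * m i‖ ≤ ‖c‖ * C := fun i => by
    rw [norm_mul]
    exact mul_le_mul_of_nonneg_left (hm i) (norm_nonneg _)
  rw [repr_mulOp B h, map_smul, lp.coeFn_smul, Pi.smul_apply, repr_mulOp B hm, smul_eq_mul,
    mul_assoc]

theorem mulOp_one (v : Lp ℂ 2 μ) : mulOp B (fun _ => 1) v = v := by
  refine eq_of_repr_eq B fun i => ?_
  rw [repr_mulOp B (C := 1) (by simp), one_mul]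

theorem norm_mulOp_le {m : ι → ℂ} {C : ℝ} (hC : 0 ≤ C) (hm : ∀ i, ‖m i‖ ≤ C) (v : Lp ℂ 2 μ) :
    ‖mulOp B m v‖ ≤ C * ‖v‖ := by
  refine le_of_sq_le_sq ?_ (by positivity)
  have hone := norm_sq_mulOp B (m := fun _ => 1) (C := 1) (by simp) v
  rw [mulOp_one] at hone
  rw [norm_sq_mulOp B hm, mul_pow, hone, ← tsum_mul_left]
  have hsum : Summable fun i => ‖B.repr v i‖ ^ 2 := by
    simpa only [ENNReal.toReal_ofNat, Real.rpow_two] using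
      (lp.memℓp (B.repr v)).summable (by simp)
  have hle : ∀ i, ‖m i‖ ^ 2 * ‖B.repr v i‖ ^ 2 ≤ C ^ 2 * ‖B.repr v i‖ ^ 2 := fun i => by
    gcongr
    exact hm i
  simp only [norm_one, one_pow, one_mul]
  exact Summable.tsum_le_tsum hle
    (Summable.of_nonneg_of_le (fun i => by positivity) hle (hsum.mul_left _)) (hsum.mul_left _)

/-- The operator depends strongly continuously on its symbol, for pointwise convergence of uniformly
bounded symbols. -/
theorem continuous_mulOp {m : ℝ → ι → ℂ} {C : ℝ} (hm : ∀ t i, ‖m t i‖ ≤ C)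
    (hc : ∀ i, Continuous fun t => m t i) (v : Lp ℂ 2 μ) :
    Continuous fun t => mulOp B (m t) v := by
  refine continuous_iff_continuousAt.2 fun t₀ => ?_
  rw [ContinuousAt, tendsto_iff_norm_sub_tendsto_zero]
  have hsum : Summable fun i => (C + C) ^ 2 * ‖B.repr v i‖ ^ 2 := by
    have h := ((lp.memℓp (B.repr v)).summable (by simp)).mul_left ((C + C) ^ 2)
    simpa only [ENNReal.toReal_ofNat, Real.rpow_two] using h
  have hbd : ∀ t i, ‖m t i - m t₀ i‖ ≤ C + C := fun t i =>
    (norm_sub_le _ _).trans (add_le_add (hm t i) (hm t₀ i))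
  have h2 : Filter.Tendsto (fun t => ‖mulOp B (m t) v - mulOp B (m t₀) v‖ ^ 2) (nhds t₀)
      (nhds 0) := by
    have heq : ∀ t, ‖mulOp B (m t) v - mulOp B (m t₀) v‖ ^ 2 =
        ∑' i, ‖m t i - m t₀ i‖ ^ 2 * ‖B.repr v i‖ ^ 2 := fun t => by
      rw [mulOp_sub B (hm t) (hm t₀), norm_sq_mulOp B (hbd t)]
    simp only [heq]
    have h0 : (0 : ℝ) = ∑' i : ι, (0 : ℝ) := by simp
    rw [h0]
    refine tendsto_tsum_of_dominated_convergence hsum (fun i => ?_)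
      (Filter.Eventually.of_forall fun t i => ?_)
    · have h := ((((hc i).tendsto t₀).sub_const (m t₀ i)).norm.pow 2).mul_const (‖B.repr v i‖ ^ 2)
      simpa using h
    · rw [Real.norm_of_nonneg (by positivity)]
      gcongr
      exact hbd t i
  have h3 := h2.sqrt
  simpa [Real.sqrt_sq] using h3

/-- The elements of `L²(μ)` bounded by `M` in modulus almost everywhere. -/
def supBall (μ : Measure X) (M : ℝ) : Set (Lp ℂ 2 μ) :=
  {v | ∀ᵐ x ∂μ, ‖v x‖ ≤ M}

theorem convex_supBall (M : ℝ) : Convex ℝ (supBall μ M) := by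
  intro v hv w hw r s hr hs hrs
  have h1 := Lp.coeFn_add (r • v) (s • w)
  have h2 := Lp.coeFn_smul r v
  have h3 := Lp.coeFn_smul s w
  change ∀ᵐ x ∂μ, _
  filter_upwards [hv, hw, h1, h2, h3] with x hv hw h1 h2 h3
  rw [h1, Pi.add_apply, h2, h3, Pi.smul_apply, Pi.smul_apply]
  calc ‖r • v x + s • w x‖ ≤ ‖r • v x‖ + ‖s • w x‖ := norm_add_le _ _
    _ = r * ‖v x‖ + s * ‖w x‖ := by
      rw [norm_smul, norm_smul, Real.norm_of_nonneg hr, Real.norm_of_nonneg hs]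
    _ ≤ r * M + s * M := by gcongr
    _ = M := by rw [← add_mul, hrs, one_mul]

theorem isClosed_supBall (M : ℝ) : IsClosed (supBall μ M) := by
  refine isClosed_of_closure_subset fun v hv => ?_
  obtain ⟨u, hu, hlim⟩ := mem_closure_iff_seq_limit.1 hv
  obtain ⟨ns, -, hns⟩ :=
    (tendstoInMeasure_of_tendsto_Lp hlim).exists_seq_tendsto_ae
  have hall : ∀ᵐ x ∂μ, ∀ n, ‖u n x‖ ≤ M := ae_all_iff.2 hu
  change ∀ᵐ x ∂μ, _
  filter_upwards [hns, hall] with x hx hM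
  exact le_of_tendsto hx.norm (Filter.Eventually.of_forall fun n => hM _)

/-- A symbol bounded by `1` whose diagonal operator does not increase the essential supremum. -/
structure SupMultiplier (m : ι → ℂ) : Prop where
  norm_le : ∀ i, ‖m i‖ ≤ 1
  maps : ∀ M, ∀ v ∈ supBall μ M, mulOp B m v ∈ supBall μ M

variable {B}

theorem SupMultiplier.one : SupMultiplier B fun _ => 1 where
  norm_le _ := by simp
  maps M v hv := by
    rwa [mulOp_one]

theorem SupMultiplier.mul {m m' : ι → ℂ} (h : SupMultiplier B m) (h' : SupMultiplier B m') :
    SupMultiplier B fun i => m i * m' i where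
  norm_le i := by
    rw [norm_mul]
    exact mul_le_one₀ (h.norm_le i) (norm_nonneg _) (h'.norm_le i)
  maps M v hv := by
    rw [← mulOp_mul B h.norm_le h'.norm_le]
    exact h.maps M _ (h'.maps M v hv)

theorem SupMultiplier.prod {α : Type*} (s : Finset α) {m : α → ι → ℂ}
    (h : ∀ j ∈ s, SupMultiplier B (m j)) : SupMultiplier B fun i => ∏ j ∈ s, m j i := by
  classical
  induction s using Finset.induction_on with
  | empty => simpa using SupMultiplier.one
  | insert j s hj ih =>
    simp only [Finset.prod_insert hj]
    exact (h j (Finset.mem_insert_self j s)).mul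
      (ih fun k hk => h k (Finset.mem_insert_of_mem hk))

/-- An average of sup-norm contracting symbols is again one, because the balls of the essential
supremum norm are closed and convex in `L²`. -/
theorem SupMultiplier.integral {m : ℝ → ι → ℂ} (ν : Measure ℝ) [IsProbabilityMeasure ν]
    (h : ∀ᵐ t ∂ν, SupMultiplier B (m t)) (hb : ∀ t i, ‖m t i‖ ≤ 1)
    (hc : ∀ i, Continuous fun t => m t i) :
    SupMultiplier B fun i => ∫ t, m t i ∂ν := by
  have hn : ∀ i, ‖∫ t, m t i ∂ν‖ ≤ 1 := fun i => by
    simpa using norm_integral_le_of_norm_le_const (μ := ν) (Filter.Eventually.of_forall (hb · i))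
  refine ⟨hn, fun M v hv => ?_⟩
  have hbound : ∀ t, ‖mulOp B (m t) v‖ ≤ ‖v‖ := fun t => by
    simpa using norm_mulOp_le B zero_le_one (hb t) v
  have hint : Integrable (fun t => mulOp B (m t) v) ν :=
    Integrable.of_bound (continuous_mulOp B hb hc v).aestronglyMeasurable ‖v‖
      (Filter.Eventually.of_forall hbound)
  have heq : mulOp B (fun i => ∫ t, m t i ∂ν) v = ∫ t, mulOp B (m t) v ∂ν := by
    refine eq_of_repr_eq B fun i => ?_
    rw [repr_mulOp B hn, B.repr_apply_apply (∫ t, mulOp B (m t) v ∂ν), ← integral_inner hint,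
      ← integral_mul_const]
    refine integral_congr_ae (Filter.Eventually.of_forall fun t => ?_)
    simp only
    rw [← B.repr_apply_apply, repr_mulOp B (hb t)]
  rw [heq]
  exact (convex_supBall M).integral_mem (isClosed_supBall M)
    (h.mono fun t ht => ht.maps M v hv) hint

end Multiplier

/-! ### The box as a fundamental domain of the torus -/

variable {d : ℕ}

/-- The Haar probability measure on the torus `(ℝ/ℤ)^d`. -/
noncomputable abbrev torusMeasure (d : ℕ) : Measure (UnitAddTorus (Fin d)) :=
  Measure.pi fun _ => AddCircle.haarAddCircle

/-- The map from the box to the torus obtained by rescaling each side to length `1`. -/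
noncomputable def toTorus (a b : Fin d → ℝ) (x : Fin d → ℝ) : UnitAddTorus (Fin d) :=
  fun j => (((x j - a j) / (b j - a j) : ℝ) : UnitAddCircle)

/-- The section of `toTorus` with values in the half-open box `∏ j, (a j, b j]`. -/
noncomputable def ofTorus (a b : Fin d → ℝ) (t : UnitAddTorus (Fin d)) : Fin d → ℝ :=
  fun j => a j + (b j - a j) * (AddCircle.equivIoc 1 0 (t j) : ℝ)

/-- Lebesgue measure on the box, normalized to total mass `1`. -/
noncomputable def boxProb (a b : Fin d → ℝ) : Measure (Fin d → ℝ) :=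
  (∏ j, ENNReal.ofReal (b j - a j))⁻¹ • boxMeasure a b

variable {a b : Fin d → ℝ}

theorem boxProb_eq_pi (hab : ∀ j, a j < b j) :
    boxProb a b = Measure.pi fun j =>
      (ENNReal.ofReal (b j - a j))⁻¹ • (volume : Measure ℝ).restrict (Set.Ioo (a j) (b j)) := by
  have hpos : ∀ j, 0 < b j - a j := fun j => sub_pos.2 (hab j)
  have hfin : ∀ j, IsFiniteMeasure
      ((ENNReal.ofReal (b j - a j))⁻¹ • (volume : Measure ℝ).restrict (Set.Ioo (a j) (b j))) :=
    fun j => Measure.smul_finite _ (by simpa using hab j)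
  refine (Measure.pi_eq fun s hs => ?_).symm
  rw [boxProb, boxMeasure, box, volume_pi, Measure.restrict_pi_pi, Measure.smul_apply,
    Measure.pi_pi]
  simp only [Measure.smul_apply, smul_eq_mul, Finset.prod_mul_distrib]
  rw [ENNReal.prod_inv_distrib]
  intro i _ j _ _
  simp

theorem boxMeasure_eq_smul (hab : ∀ j, a j < b j) :
    boxMeasure a b = (∏ j, ENNReal.ofReal (b j - a j)) • boxProb a b := by
  rw [boxProb, smul_smul, ENNReal.mul_inv_cancel, one_smul]
  · exact Finset.prod_ne_zero_iff.2 fun j _ => by simpa using hab j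
  · exact ENNReal.prod_ne_top fun j _ => ENNReal.ofReal_ne_top

theorem measurePreserving_rescale {a b : ℝ} (hab : a < b) :
    MeasurePreserving (fun x : ℝ => (x - a) / (b - a))
      ((ENNReal.ofReal (b - a))⁻¹ • (volume : Measure ℝ).restrict (Set.Ioo a b))
      ((volume : Measure ℝ).restrict (Set.Ioc 0 1)) := by
  have hpos : 0 < b - a := sub_pos.2 hab
  have hmul : MeasurePreserving (fun x : ℝ => x * (b - a)⁻¹)
      ((ENNReal.ofReal (b - a))⁻¹ • volume) volume := by
    refine ⟨by fun_prop, ?_⟩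
    rw [Measure.map_smul]
    have h := Real.smul_map_volume_mul_right (inv_ne_zero hpos.ne')
    rwa [abs_of_pos (inv_pos.2 hpos), ENNReal.ofReal_inv_of_pos hpos] at h
  have hall := hmul.comp
    ((measurePreserving_sub_right volume a).smul_measure (ENNReal.ofReal (b - a))⁻¹)
  have hres := hall.restrict_preimage (s := Set.Ioo (0 : ℝ) 1) measurableSet_Ioo
  rw [Measure.restrict_congr_set Ioo_ae_eq_Ioc, Measure.restrict_smul] at hres
  have hset : ((fun x : ℝ => x * (b - a)⁻¹) ∘ fun x => x - a) ⁻¹' Set.Ioo (0 : ℝ) 1 =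
      Set.Ioo a b := by
    ext x
    simp only [Set.mem_preimage, Function.comp_apply, Set.mem_Ioo, ← div_eq_mul_inv]
    rw [lt_div_iff₀ hpos, div_lt_one hpos]
    constructor <;> rintro ⟨h1, h2⟩ <;> constructor <;> linarith
  rw [hset] at hres
  exact hres

theorem measurePreserving_toTorus (hab : ∀ j, a j < b j) :
    MeasurePreserving (toTorus a b) (boxProb a b) (torusMeasure d) := by
  rw [boxProb_eq_pi hab]
  refine measurePreserving_pi _ _
    (f := fun j (x : ℝ) => (((x - a j) / (b j - a j) : ℝ) : UnitAddCircle)) fun j => ?_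
  have h := UnitAddCircle.measurePreserving_mk 0
  rw [zero_add, AddCircle.volume_eq_smul_haarAddCircle, ENNReal.ofReal_one, one_smul] at h
  exact h.comp (measurePreserving_rescale (hab j))

theorem toTorus_ofTorus (hab : ∀ j, a j < b j) (t : UnitAddTorus (Fin d)) :
    toTorus a b (ofTorus a b t) = t := by
  funext j
  have hpos : b j - a j ≠ 0 := (sub_pos.2 (hab j)).ne'
  simp only [toTorus, ofTorus, add_sub_cancel_left, mul_div_cancel_left₀ _ hpos]
  exact (AddCircle.equivIoc 1 0).symm_apply_apply (t j)

theorem ofTorus_toTorus {x : Fin d → ℝ} (hx : x ∈ box a b) : ofTorus a b (toTorus a b x) = x := by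
  funext j
  obtain ⟨h1, h2⟩ := hx j (Set.mem_univ j)
  have hpos : 0 < b j - a j := by linarith
  have hmem : (x j - a j) / (b j - a j) ∈ Set.Ioc (0 : ℝ) (0 + 1) := by
    rw [zero_add]
    exact ⟨div_pos (by linarith) hpos, (div_le_one hpos).2 (by linarith)⟩
  simp only [toTorus, ofTorus, AddCircle.equivIoc_coe_eq hmem]
  field_simp
  ring

theorem ae_mem_box : ∀ᵐ x ∂boxMeasure a b, x ∈ box a b :=
  ae_restrict_mem (MeasurableSet.univ_pi fun _ => measurableSet_Ioo)

theorem measurePreserving_ofTorus (hab : ∀ j, a j < b j) :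
    MeasurePreserving (ofTorus a b) (torusMeasure d) (boxProb a b) := by
  have hmeas : Measurable (ofTorus a b) := by
    refine measurable_pi_lambda _ fun j => ?_
    have h : Measurable fun t : UnitAddCircle => (AddCircle.equivIoc 1 0 t : ℝ) :=
      measurable_subtype_coe.comp (AddCircle.measurableEquivIoc 1 0).measurable
    exact ((h.comp (measurable_pi_apply j)).const_mul _).const_add _
  refine ⟨hmeas, ?_⟩
  rw [← (measurePreserving_toTorus hab).map_eq,
    Measure.map_map hmeas (measurePreserving_toTorus hab).measurable]
  have hid : ofTorus a b ∘ toTorus a b =ᵐ[boxProb a b] id :=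
    Measure.ae_smul_measure (ae_mem_box.mono fun x hx => ofTorus_toTorus hx) _
  rw [Measure.map_congr hid, Measure.map_id]

theorem expMode_eq_mFourier (k : Fin d → ℤ) (x : Fin d → ℝ) :
    expMode a b k x = UnitAddTorus.mFourier k (toTorus a b x) := by
  simp only [expMode, toTorus, UnitAddTorus.mFourier, ContinuousMap.coe_mk, fourier_coe_apply]
  rw [← Complex.exp_sum]
  congr 1
  push_cast
  rw [Finset.mul_sum, Finset.sum_mul]
  refine Finset.sum_congr rfl fun j _ => ?_
  ring

theorem continuous_expMode (k : Fin d → ℤ) : Continuous (expMode a b k) := by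
  unfold expMode
  fun_prop

theorem expMode_neg (k : Fin d → ℤ) (x : Fin d → ℝ) :
    expMode a b (-k) x = (starRingEnd ℂ) (expMode a b k x) := by
  rw [expMode_eq_mFourier, expMode_eq_mFourier, UnitAddTorus.mFourier_neg]

theorem integral_expMode_mul (hab : ∀ j, a j < b j) (k l : Fin d → ℤ) :
    ∫ x, (starRingEnd ℂ) (expMode a b k x) * expMode a b l x ∂boxProb a b =
      if k = l then 1 else 0 := by
  have h := orthonormal_iff_ite.1 (UnitAddTorus.orthonormal_mFourier (d := Fin d)) k l
  rw [ContinuousMap.inner_toLp] at h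
  rw [← h]
  change _ = ∫ t, UnitAddTorus.mFourier l t * (starRingEnd ℂ) (UnitAddTorus.mFourier k t)
    ∂torusMeasure d
  rw [← (measurePreserving_toTorus hab).map_eq, integral_map
    (measurePreserving_toTorus hab).aemeasurable (Continuous.aestronglyMeasurable (by fun_prop))]
  refine integral_congr_ae (Filter.Eventually.of_forall fun x => ?_)
  simp only [expMode_eq_mFourier]
  rw [mul_comm]

/-- The periodic exponentials are complete in `L²` of the box. -/
theorem ae_eq_zero_of_integral_expMode_eq_zero (hab : ∀ j, a j < b j) {v : (Fin d → ℝ) → ℂ}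
    (hv : MemLp v 2 (boxProb a b))
    (h : ∀ k, ∫ x, (starRingEnd ℂ) (expMode a b k x) * v x ∂boxProb a b = 0) :
    v =ᵐ[boxProb a b] 0 := by
  have hσ := measurePreserving_ofTorus hab
  have hV : MemLp (v ∘ ofTorus a b) 2 (torusMeasure d) := hv.comp_measurePreserving hσ
  have hmeas : ∀ k, AEStronglyMeasurable
      (fun x => (starRingEnd ℂ) (expMode a b k x) * v x)
      ((torusMeasure d).map (ofTorus a b)) := fun k =>
    (Complex.continuous_conj.comp (continuous_expMode k)).aestronglyMeasurable.mul
      (hσ.map_eq ▸ hv.1)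
  have hzero : hV.toLp _ = 0 := by
    refine UnitAddTorus.mFourierBasis.repr.injective (lp.ext (funext fun k => ?_))
    rw [map_zero, lp.coeFn_zero, Pi.zero_apply, UnitAddTorus.mFourierBasis_repr,
      UnitAddTorus.mFourierCoeff, ← h k, ← hσ.map_eq,
      integral_map hσ.aemeasurable (hmeas k)]
    refine integral_congr_ae ?_
    filter_upwards [hV.coeFn_toLp] with t ht
    rw [ht, UnitAddTorus.mFourier_neg, expMode_eq_mFourier, toTorus_ofTorus hab, smul_eq_mul,
      Function.comp_apply]
  have hV0 : v ∘ ofTorus a b =ᵐ[torusMeasure d] 0 :=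
    hV.coeFn_toLp.symm.trans (hzero ▸ Lp.coeFn_zero _ _ _)
  have hbox : ∀ᵐ x ∂boxProb a b, x ∈ box a b := Measure.ae_smul_measure ae_mem_box _
  filter_upwards [(measurePreserving_toTorus hab).quasiMeasurePreserving.ae hV0, hbox] with x hx hxb
  rwa [Function.comp_apply, ofTorus_toTorus hxb] at hx

/-! ### The Fourier basis of the box and translations -/

theorem integral_boxMeasure (hab : ∀ j, a j < b j) (g : (Fin d → ℝ) → ℂ) :
    ∫ x, g x ∂boxMeasure a b = (∏ j, (b j - a j) : ℝ) * ∫ x, g x ∂boxProb a b := by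
  rw [boxMeasure_eq_smul hab, integral_smul_measure, ENNReal.toReal_prod, Complex.real_smul]
  rw [Finset.prod_congr rfl fun j _ => ENNReal.toReal_ofReal (sub_pos.2 (hab j)).le]

theorem inner_toLp_expMode (k : Fin d → ℤ) (v : Lp ℂ 2 (boxMeasure a b)) :
    inner ℂ ((memLp_expMode a b k).toLp (expMode a b k)) v =
      ∫ x, (starRingEnd ℂ) (expMode a b k x) * v x ∂boxMeasure a b := by
  rw [L2.inner_def]
  refine integral_congr_ae ?_
  filter_upwards [(memLp_expMode a b k).coeFn_toLp] with x hx
  rw [hx, RCLike.inner_apply, mul_comm]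

theorem prod_side_pos (hab : ∀ j, a j < b j) : 0 < ∏ j, (b j - a j) :=
  Finset.prod_pos fun j _ => sub_pos.2 (hab j)

/-- The periodic exponential normalized in `L²` of the box. -/
noncomputable def normMode (a b : Fin d → ℝ) (k : Fin d → ℤ) : Lp ℂ 2 (boxMeasure a b) :=
  (((√(∏ j, (b j - a j)))⁻¹ : ℝ) : ℂ) • (memLp_expMode a b k).toLp (expMode a b k)

theorem inner_normMode (k : Fin d → ℤ) (v : Lp ℂ 2 (boxMeasure a b)) :
    inner ℂ (normMode a b k) v = (((√(∏ j, (b j - a j)))⁻¹ : ℝ) : ℂ) *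
      ∫ x, (starRingEnd ℂ) (expMode a b k x) * v x ∂boxMeasure a b := by
  rw [normMode, inner_smul_left, inner_toLp_expMode, Complex.conj_ofReal]

theorem orthonormal_normMode (hab : ∀ j, a j < b j) : Orthonormal ℂ (normMode a b) := by
  rw [orthonormal_iff_ite]
  intro k l
  rw [inner_normMode]
  have h : ∫ x, (starRingEnd ℂ) (expMode a b k x) * normMode a b l x ∂boxMeasure a b =
      (((√(∏ j, (b j - a j)))⁻¹ : ℝ) : ℂ) *
        ∫ x, (starRingEnd ℂ) (expMode a b k x) * expMode a b l x ∂boxMeasure a b := by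
    rw [← integral_const_mul]
    refine integral_congr_ae ?_
    filter_upwards [(memLp_expMode a b l).coeFn_toLp, Lp.coeFn_smul
      (((√(∏ j, (b j - a j)))⁻¹ : ℝ) : ℂ) ((memLp_expMode a b l).toLp (expMode a b l))]
      with x h1 h2
    rw [normMode, h2, Pi.smul_apply, h1, smul_eq_mul]
    ring
  rw [h, integral_boxMeasure hab, integral_expMode_mul hab, ← mul_assoc, ← mul_assoc]
  have hc := prod_side_pos hab
  have hone : (((√(∏ j, (b j - a j)))⁻¹ : ℝ) : ℂ) * (((√(∏ j, (b j - a j)))⁻¹ : ℝ) : ℂ) *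
      ((∏ j, (b j - a j) : ℝ) : ℂ) = 1 := by
    rw [← Complex.ofReal_mul, ← Complex.ofReal_mul, ← mul_inv, Real.mul_self_sqrt hc.le,
      inv_mul_cancel₀ hc.ne', Complex.ofReal_one]
  rw [hone, one_mul]

theorem absolutelyContinuous_boxMeasure (hab : ∀ j, a j < b j) :
    boxMeasure a b ≪ boxProb a b := by
  rw [boxMeasure_eq_smul hab]
  exact Measure.smul_absolutelyContinuous

theorem span_normMode_orthogonal (hab : ∀ j, a j < b j) :
    (Submodule.span ℂ (Set.range (normMode a b)))ᗮ = ⊥ := by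
  refine (Submodule.eq_bot_iff _).2 fun v hv => ?_
  have hc := prod_side_pos hab
  have hv2 : MemLp v 2 (boxProb a b) :=
    (Lp.memLp v).smul_measure (ENNReal.inv_ne_top.2
      (Finset.prod_ne_zero_iff.2 fun j _ => by simpa using hab j))
  have h0 : v =ᵐ[boxProb a b] 0 := by
    refine ae_eq_zero_of_integral_expMode_eq_zero hab hv2 fun k => ?_
    have h := hv _ (Submodule.subset_span ⟨k, rfl⟩)
    rw [inner_normMode, integral_boxMeasure hab] at h
    have h1 : (((√(∏ j, (b j - a j)))⁻¹ : ℝ) : ℂ) ≠ 0 :=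
      Complex.ofReal_ne_zero.2 (inv_ne_zero (Real.sqrt_ne_zero'.2 hc))
    exact (mul_eq_zero.1 ((mul_eq_zero.1 h).resolve_left h1)).resolve_left
      (Complex.ofReal_ne_zero.2 hc.ne')
  exact (Lp.eq_zero_iff_ae_eq_zero).2 (absolutelyContinuous_boxMeasure hab h0)

/-- The normalized periodic exponentials as a Hilbert basis of `L²` of the box. -/
noncomputable def modeBasis (hab : ∀ j, a j < b j) :
    HilbertBasis (Fin d → ℤ) ℂ (Lp ℂ 2 (boxMeasure a b)) :=
  HilbertBasis.mkOfOrthogonalEqBot (orthonormal_normMode hab) (span_normMode_orthogonal hab)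

theorem modeBasis_repr (hab : ∀ j, a j < b j) (v : Lp ℂ 2 (boxMeasure a b)) (k : Fin d → ℤ) :
    (modeBasis hab).repr v k = (((√(∏ j, (b j - a j)))⁻¹ : ℝ) : ℂ) *
      ∫ x, (starRingEnd ℂ) (expMode a b k x) * v x ∂boxMeasure a b := by
  rw [HilbertBasis.repr_apply_apply, modeBasis, HilbertBasis.coe_mkOfOrthogonalEqBot,
    inner_normMode]

theorem modeBasis_apply (hab : ∀ j, a j < b j) (k : Fin d → ℤ) :
    modeBasis hab k = normMode a b k := by
  rw [modeBasis, HilbertBasis.coe_mkOfOrthogonalEqBot]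

/-- Translation by `y`, measured in units of the side lengths, on the box with opposite faces
identified. -/
noncomputable def boxShift (a b : Fin d → ℝ) (y : UnitAddTorus (Fin d)) (x : Fin d → ℝ) :
    Fin d → ℝ :=
  ofTorus a b (y + toTorus a b x)

theorem measurePreserving_boxShift (hab : ∀ j, a j < b j) (y : UnitAddTorus (Fin d)) :
    MeasurePreserving (boxShift a b y) (boxMeasure a b) (boxMeasure a b) := by
  have h : MeasurePreserving (fun t : UnitAddTorus (Fin d) => y + t) (torusMeasure d)
      (torusMeasure d) :=
    measurePreserving_pi _ _ (f := fun j t => y j + t) fun j =>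
      measurePreserving_add_left AddCircle.haarAddCircle (y j)
  rw [boxMeasure_eq_smul hab]
  exact ((measurePreserving_ofTorus hab).comp
    (h.comp (measurePreserving_toTorus hab))).smul_measure _

/-- Translations act on the Fourier side by unimodular symbols, and they preserve sup bounds. -/
theorem supMultiplier_translation (hab : ∀ j, a j < b j) (y : UnitAddTorus (Fin d)) :
    SupMultiplier (modeBasis hab) fun k => UnitAddTorus.mFourier k y := by
  have hS := measurePreserving_boxShift hab y
  have hnorm : ∀ k, ‖UnitAddTorus.mFourier k y‖ = 1 := fun k => by
    simp only [UnitAddTorus.mFourier, ContinuousMap.coe_mk, fourier_apply, norm_prod,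
      Circle.norm_coe, Finset.prod_const_one]
  refine ⟨fun k => (hnorm k).le, fun M v hv => ?_⟩
  have heq : mulOp (modeBasis hab) (fun k => UnitAddTorus.mFourier k y) v =
      Lp.compMeasurePreserving (boxShift a b y) hS v := by
    refine eq_of_repr_eq (modeBasis hab) fun k => ?_
    rw [repr_mulOp _ (fun k => (hnorm k).le), modeBasis_repr, modeBasis_repr]
    have hmeas : AEStronglyMeasurable (fun x => (starRingEnd ℂ) (expMode a b k x) * v x)
        ((boxMeasure a b).map (boxShift a b y)) :=
      (Complex.continuous_conj.comp (continuous_expMode k)).aestronglyMeasurable.mul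
        (hS.map_eq.symm ▸ (Lp.memLp v).1)
    have hint : ∫ x, (starRingEnd ℂ) (expMode a b k x) *
        Lp.compMeasurePreserving (boxShift a b y) hS v x ∂boxMeasure a b =
        UnitAddTorus.mFourier k y *
          ∫ x, (starRingEnd ℂ) (expMode a b k x) * v x ∂boxMeasure a b := by
      have hchange := integral_map hS.aemeasurable hmeas
      rw [hS.map_eq] at hchange
      rw [hchange, ← integral_const_mul]
      refine integral_congr_ae ?_
      filter_upwards [Lp.coeFn_compMeasurePreserving v hS] with x hx
      rw [hx, Function.comp_apply]
      have he : expMode a b k (boxShift a b y x) =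
          UnitAddTorus.mFourier k y * expMode a b k x := by
        rw [expMode_eq_mFourier, expMode_eq_mFourier, boxShift, toTorus_ofTorus hab]
        simp only [UnitAddTorus.mFourier, ContinuousMap.coe_mk, Pi.add_apply,
          smul_add, AddCircle.toCircle_add, Circle.coe_mul, fourier_apply,
          Finset.prod_mul_distrib]
      have hu : UnitAddTorus.mFourier k y * (starRingEnd ℂ) (UnitAddTorus.mFourier k y) = 1 := by
        rw [Complex.mul_conj, Complex.normSq_eq_norm_sq, hnorm]
        simp
      rw [he, map_mul]
      linear_combination (-(starRingEnd ℂ) (expMode a b k x) * v (boxShift a b y x)) * hu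
    rw [hint]
    ring
  rw [heq]
  change ∀ᵐ x ∂boxMeasure a b, _
  filter_upwards [Lp.coeFn_compMeasurePreserving v hS, hS.quasiMeasurePreserving.ae hv]
    with x h1 h2
  rw [h1]
  exact h2

/-! ### The heat semigroup as a Gaussian average of translations -/

theorem eigenvalue_le (ε κ : ℝ) (k : Fin d → ℤ) : eigenvalue a b ε κ k ≤ -κ := by
  have h : 0 ≤ ε ^ 2 * ∑ j, (2 * Real.pi * k j / (b j - a j)) ^ 2 :=
    mul_nonneg (sq_nonneg _) (Finset.sum_nonneg fun j _ => sq_nonneg _)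
  unfold eigenvalue
  linarith

theorem eigenvalue_neg (ε κ : ℝ) (k : Fin d → ℤ) :
    eigenvalue a b ε κ (-k) = eigenvalue a b ε κ k := by
  unfold eigenvalue
  congr 3
  refine Finset.sum_congr rfl fun j _ => ?_
  rw [Pi.neg_apply, Int.cast_neg]
  ring

theorem mFourier_single_coe (k : Fin d → ℤ) (j : Fin d) (θ : ℝ) :
    UnitAddTorus.mFourier k (Pi.single j (θ : UnitAddCircle)) =
      Complex.exp (((2 * Real.pi * k j : ℝ) : ℂ) * θ * Complex.I) := by
  simp only [UnitAddTorus.mFourier, ContinuousMap.coe_mk]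
  rw [Finset.prod_eq_single j]
  · rw [Pi.single_eq_same, fourier_coe_apply]
    congr 1
    push_cast
    ring
  · intro i _ hi
    rw [Pi.single_eq_of_ne hi, fourier_eval_zero]
  · simp

/-- A Gaussian average of translations in direction `j`: its symbol is the characteristic function
of the Gaussian distribution. -/
theorem supMultiplier_gaussian (hab : ∀ j, a j < b j) (j : Fin d) {r : ℝ} (hr : 0 ≤ r) :
    SupMultiplier (modeBasis hab) fun k => (Real.exp (-(r * (2 * Real.pi * k j) ^ 2)) : ℂ) := by
  have h := SupMultiplier.integral (B := modeBasis hab)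
    (m := fun θ k => UnitAddTorus.mFourier k (Pi.single j (θ : UnitAddCircle)))
    (ProbabilityTheory.gaussianReal 0 (2 * r).toNNReal)
    (Filter.Eventually.of_forall fun θ => supMultiplier_translation hab _)
    (fun θ k => (supMultiplier_translation hab _).norm_le k)
    (fun k => by
      simp only [mFourier_single_coe]
      fun_prop)
  convert h using 2 with k
  simp only [mFourier_single_coe]
  rw [← charFun_apply_real, ProbabilityTheory.charFun_gaussianReal, Complex.ofReal_exp,
    Real.coe_toNNReal _ (by linarith)]
  congr 1
  push_cast
  ring

/-- The symbol of the heat semigroup `e^{t ε² Δ}`. -/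
theorem supMultiplier_heat (hab : ∀ j, a j < b j) (ε κ : ℝ) {t : ℝ} (ht : 0 ≤ t) :
    SupMultiplier (modeBasis hab) fun k =>
      (Real.exp (t * (eigenvalue a b ε κ k + κ)) : ℂ) := by
  have h := SupMultiplier.prod (B := modeBasis hab) Finset.univ fun j _ =>
    supMultiplier_gaussian hab j (r := t * ε ^ 2 / (b j - a j) ^ 2) (by positivity)
  convert h using 2 with k
  rw [← Complex.ofReal_prod, ← Real.exp_sum]
  congr 2
  unfold eigenvalue
  rw [sub_add_cancel, mul_neg, Finset.mul_sum, Finset.mul_sum, ← Finset.sum_neg_distrib]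
  refine Finset.sum_congr rfl fun j _ => ?_
  rw [div_pow]
  ring

theorem integral_exp_mul {z s : ℝ} (hz : z ≠ 0) :
    ∫ t in (0 : ℝ)..s, Real.exp (t * z) = (Real.exp (s * z) - 1) / z := by
  rw [intervalIntegral.integral_comp_mul_right _ hz, integral_exp]
  simp [div_eq_inv_mul]

theorem one_sub_exp_neg_pos {x : ℝ} (hx : 0 < x) : 0 < 1 - Real.exp (-x) :=
  sub_pos.2 (Real.exp_lt_one_iff.2 (neg_neg_of_pos hx))

/-- The symbol of `(e^{s L_κ} - 1) L_κ⁻¹ = ∫ t in 0..s, e^{t L_κ}`, divided by its largest value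
`(1 - e^{-κ s}) / κ`: an average of heat semigroups with weight proportional to `e^{-κ t}`. -/
theorem supMultiplier_duhamel (hab : ∀ j, a j < b j) (ε : ℝ) {κ s : ℝ} (hκ : 0 < κ)
    (hs : 0 < s) :
    SupMultiplier (modeBasis hab) fun k =>
      ((κ / (1 - Real.exp (-(κ * s))) * ((Real.exp (s * eigenvalue a b ε κ k) - 1) /
        eigenvalue a b ε κ k) : ℝ) : ℂ) := by
  have hden := one_sub_exp_neg_pos (mul_pos hκ hs)
  set A : ℝ := κ / (1 - Real.exp (-(κ * s))) with hA
  have hApos : 0 < A := div_pos hκ hden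
  set ρ : ℝ → ℝ := fun t => A * Real.exp (t * -κ) with hρ
  have hρ0 : ∀ t, 0 ≤ ρ t := fun t => by positivity
  have hρc : Continuous ρ := by fun_prop
  set ν : Measure ℝ := (volume.restrict (Set.Ioc 0 s)).withDensity fun t => ENNReal.ofReal (ρ t)
    with hν
  have hmass : ∫ t in (0 : ℝ)..s, ρ t = 1 := by
    rw [hρ, intervalIntegral.integral_const_mul, integral_exp_mul (neg_ne_zero.2 hκ.ne'), hA]
    rw [show s * -κ = -(κ * s) by ring]
    field_simp
    ring
  have hprob : IsProbabilityMeasure ν := by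
    refine ⟨?_⟩
    rw [hν, withDensity_apply _ MeasurableSet.univ, Measure.restrict_univ,
      ← ofReal_integral_eq_lintegral_ofReal, ← intervalIntegral.integral_of_le hs.le, hmass,
      ENNReal.ofReal_one]
    · exact (hρc.integrableOn_Icc).mono_set Set.Ioc_subset_Icc_self
    · exact Filter.Eventually.of_forall hρ0
  -- `|t|` extends the family of symbols to a bounded continuous one on the whole line.
  have hheat : ∀ t : ℝ, SupMultiplier (modeBasis hab) fun k =>
      (Real.exp (|t| * (eigenvalue a b ε κ k + κ)) : ℂ) := fun t =>
    supMultiplier_heat hab ε κ (abs_nonneg t)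
  have h := SupMultiplier.integral ν (Filter.Eventually.of_forall hheat)
    (fun t k => (hheat t).norm_le k) (fun k => by fun_prop)
  convert h using 2 with k
  have hz : eigenvalue a b ε κ k ≠ 0 := (lt_of_le_of_lt (eigenvalue_le ε κ k) (by linarith)).ne
  rw [integral_complex_ofReal, hν, integral_withDensity_eq_integral_toReal_smul (by fun_prop)
    (Filter.Eventually.of_forall fun t => ENNReal.ofReal_lt_top), ← integral_exp_mul hz,
    ← intervalIntegral.integral_const_mul, intervalIntegral.integral_of_le hs.le]
  congr 1
  refine setIntegral_congr_fun measurableSet_Ioc fun t ht => ?_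
  simp only [ENNReal.toReal_ofReal (hρ0 t), smul_eq_mul]
  rw [abs_of_pos ht.1, hρ, mul_assoc, ← Real.exp_add]
  congr 2
  ring

/-! ### Functions of the operator on bounded functions -/

theorem isFiniteMeasure_boxMeasure (a b : Fin d → ℝ) : IsFiniteMeasure (boxMeasure a b) := by
  refine ⟨?_⟩
  rw [boxMeasure, Measure.restrict_apply_univ, box, Real.volume_pi_Ioo]
  exact ENNReal.prod_lt_top fun i _ => ENNReal.ofReal_lt_top

/-- A measurable function on the box with `|v| ≤ M` almost everywhere. -/
structure EssBdd (a b : Fin d → ℝ) (M : ℝ) (v : (Fin d → ℝ) → ℝ) : Prop where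
  aestronglyMeasurable : AEStronglyMeasurable v (boxMeasure a b)
  abs_le : ∀ᵐ x ∂boxMeasure a b, |v x| ≤ M

theorem EssBdd.mono {M N : ℝ} {v : (Fin d → ℝ) → ℝ} (h : EssBdd a b M v) (hMN : M ≤ N) :
    EssBdd a b N v :=
  ⟨h.1, h.2.mono fun _ hx => hx.trans hMN⟩

theorem EssBdd.congr {M : ℝ} {v w : (Fin d → ℝ) → ℝ} (h : EssBdd a b M v)
    (hvw : w =ᵐ[boxMeasure a b] v) : EssBdd a b M w := by
  refine ⟨h.1.congr hvw.symm, ?_⟩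
  filter_upwards [h.2, hvw] with x h1 h2
  rwa [h2]

theorem EssBdd.add {M N : ℝ} {v w : (Fin d → ℝ) → ℝ} (hv : EssBdd a b M v)
    (hw : EssBdd a b N w) : EssBdd a b (M + N) (v + w) := by
  refine ⟨hv.1.add hw.1, ?_⟩
  filter_upwards [hv.2, hw.2] with x h1 h2
  exact (abs_add_le _ _).trans (add_le_add h1 h2)

theorem EssBdd.const_smul {M c : ℝ} {v : (Fin d → ℝ) → ℝ} (hv : EssBdd a b M v) (hc : 0 ≤ c) :
    EssBdd a b (c * M) (c • v) := by
  refine ⟨hv.1.const_smul c, ?_⟩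
  filter_upwards [hv.2] with x h
  rw [Pi.smul_apply, smul_eq_mul, abs_mul, abs_of_nonneg hc]
  gcongr

theorem EssBdd.sum {ι : Type*} (s : Finset ι) {M : ι → ℝ} {v : ι → (Fin d → ℝ) → ℝ}
    (h : ∀ i ∈ s, EssBdd a b (M i) (v i)) : EssBdd a b (∑ i ∈ s, M i) (∑ i ∈ s, v i) := by
  classical
  induction s using Finset.induction_on with
  | empty => exact ⟨aestronglyMeasurable_zero, by simp⟩
  | insert i s hi ih =>
    rw [Finset.sum_insert hi, Finset.sum_insert hi]
    exact (h i (Finset.mem_insert_self i s)).add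
      (ih fun k hk => h k (Finset.mem_insert_of_mem hk))

theorem EssBdd.nonlin {κ β : ℝ} {f : ℝ → ℝ} (hf : ContDiff ℝ 1 f) (hβ : 0 ≤ β)
    (hfβ : f β ≤ 0) (hfβ' : 0 ≤ f (-β)) (hκf : ∀ ξ ∈ Set.Icc (-β) β, |deriv f ξ| ≤ κ)
    {v : (Fin d → ℝ) → ℝ} (hv : EssBdd a b β v) : EssBdd a b (κ * β) (nonlin κ f v) :=
  ⟨(hf.continuous.comp_aestronglyMeasurable hv.1).add (hv.1.const_mul κ),
    hv.2.mono fun _ hx => abs_add_mul_le hf hβ hfβ hfβ' hκf hx⟩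

theorem EssBdd.exists_L2 {M : ℝ} {v : (Fin d → ℝ) → ℝ} (hv : EssBdd a b M v) :
    ∃ V : Lp ℂ 2 (boxMeasure a b),
      (∀ᵐ x ∂boxMeasure a b, V x = (v x : ℂ)) ∧ V ∈ supBall (boxMeasure a b) M := by
  have := isFiniteMeasure_boxMeasure a b
  have hmem : MemLp (fun x => (v x : ℂ)) 2 (boxMeasure a b) :=
    MemLp.of_bound (Complex.continuous_ofReal.comp_aestronglyMeasurable hv.1) M
      (hv.2.mono fun x hx => by rwa [Complex.norm_real, Real.norm_eq_abs])
  refine ⟨hmem.toLp _, hmem.coeFn_toLp, ?_⟩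
  change ∀ᵐ x ∂boxMeasure a b, _
  filter_upwards [hmem.coeFn_toLp, hv.2] with x h1 h2
  rwa [h1, Complex.norm_real, Real.norm_eq_abs]

/-- The series defining `φ(L_κ) v` is the diagonal operator in the normalized Fourier basis. -/
theorem opFun_eq_re_mulOp (hab : ∀ j, a j < b j) (ε κ : ℝ) (φ : ℝ → ℝ) {v : (Fin d → ℝ) → ℝ}
    {V : Lp ℂ 2 (boxMeasure a b)} (hV : ∀ᵐ x ∂boxMeasure a b, V x = (v x : ℂ)) :
    opFun a b ε κ φ v = fun x => Complex.re
      (mulOp (modeBasis hab) (fun k => (φ (eigenvalue a b ε κ k) : ℂ)) V x) := by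
  have hc := prod_side_pos hab
  have hterm : ∀ k, ((φ (eigenvalue a b ε κ k) : ℂ) * coeff a b v k) •
      (memLp_expMode a b k).toLp (expMode a b k) =
      ((φ (eigenvalue a b ε κ k) : ℂ) * (modeBasis hab).repr V k) • modeBasis hab k := by
    intro k
    have hint : ∫ x, (starRingEnd ℂ) (expMode a b k x) * V x ∂boxMeasure a b =
        ∫ x, (starRingEnd ℂ) (expMode a b k x) * (v x : ℂ) ∂boxMeasure a b :=
      integral_congr_ae (hV.mono fun x hx => by simp only [hx])
    rw [modeBasis_repr, modeBasis_apply, normMode, smul_smul, hint, coeff]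
    congr 1
    have hsq : ((∏ j, (b j - a j))⁻¹ : ℝ) =
        (√(∏ j, (b j - a j)))⁻¹ * (√(∏ j, (b j - a j)))⁻¹ := by
      rw [← mul_inv, Real.mul_self_sqrt hc.le]
    rw [hsq, Complex.ofReal_mul]
    ring
  funext x
  unfold opFun mulOp
  simp only [hterm]

theorem EssBdd.opFun (hab : ∀ j, a j < b j) {ε κ : ℝ} {φ : ℝ → ℝ} {m : (Fin d → ℤ) → ℂ}
    (hm : SupMultiplier (modeBasis hab) m) {C : ℝ} (hC : 0 ≤ C)
    (hφ : ∀ k, (φ (eigenvalue a b ε κ k) : ℂ) = C * m k)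
    {M : ℝ} {v : (Fin d → ℝ) → ℝ} (hv : EssBdd a b M v) :
    EssBdd a b (C * M) (opFun a b ε κ φ v) := by
  obtain ⟨V, hV, hVM⟩ := hv.exists_L2
  rw [opFun_eq_re_mulOp hab ε κ φ hV]
  refine ⟨Complex.continuous_re.comp_aestronglyMeasurable (Lp.memLp _).1, ?_⟩
  simp only [hφ]
  rw [mulOp_const_mul _ _ hm.norm_le]
  filter_upwards [Lp.coeFn_smul (C : ℂ) (mulOp (modeBasis hab) m V), hm.maps M V hVM] with x h1 h2
  rw [h1, Pi.smul_apply]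
  refine (Complex.abs_re_le_norm _).trans ?_
  rw [norm_smul, Complex.norm_real, Real.norm_of_nonneg hC]
  gcongr

/-- For a real function, the symbols `φ(λ_k)`, which are real and even in `k`, give real
functions. -/
theorem mulOp_ofReal_eq_re (hab : ∀ j, a j < b j) (ε κ : ℝ) {φ : ℝ → ℝ} {C : ℝ}
    (hφ : ∀ k, |φ (eigenvalue a b ε κ k)| ≤ C) {v : (Fin d → ℝ) → ℝ}
    {V : Lp ℂ 2 (boxMeasure a b)} (hV : ∀ᵐ x ∂boxMeasure a b, V x = (v x : ℂ)) :
    ∀ᵐ x ∂boxMeasure a b,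
      mulOp (modeBasis hab) (fun k => (φ (eigenvalue a b ε κ k) : ℂ)) V x = (Complex.re
        (mulOp (modeBasis hab) (fun k => (φ (eigenvalue a b ε κ k) : ℂ)) V x) : ℂ) := by
  have hrepr : ∀ (W : Lp ℂ 2 (boxMeasure a b)) k,
      (modeBasis hab).repr (star W) k = (starRingEnd ℂ) ((modeBasis hab).repr W (-k)) := by
    intro W k
    rw [modeBasis_repr, modeBasis_repr, map_mul, Complex.conj_ofReal, ← integral_conj]
    congr 1
    refine integral_congr_ae ?_
    filter_upwards [Lp.coeFn_star W] with x hx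
    rw [hx, expMode_neg, Pi.star_apply, map_mul, RCLike.star_def, Complex.conj_conj]
  have hVstar : star V = V := by
    refine Lp.ext ?_
    filter_upwards [Lp.coeFn_star V, hV] with x h1 h2
    rw [h1, Pi.star_apply, h2, RCLike.star_def, Complex.conj_ofReal]
  have hb : ∀ k, ‖(φ (eigenvalue a b ε κ k) : ℂ)‖ ≤ C := fun k => by
    rw [Complex.norm_real]
    exact hφ k
  set W := mulOp (modeBasis hab) (fun k => (φ (eigenvalue a b ε κ k) : ℂ)) V with hW
  have hWstar : star W = W := by
    refine eq_of_repr_eq (modeBasis hab) fun k => ?_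
    rw [hrepr, hW, repr_mulOp _ hb, repr_mulOp _ hb, map_mul, Complex.conj_ofReal, eigenvalue_neg,
      ← hrepr, hVstar]
  have hWx := Lp.coeFn_star W
  rw [hWstar] at hWx
  filter_upwards [hWx] with x hx
  rw [Pi.star_apply, RCLike.star_def] at hx
  exact (Complex.conj_eq_iff_re.1 hx.symm).symm

/-- `e^{s L_κ} L_κ⁻¹ - L_κ⁻¹` is the function `z ↦ (e^{s z} - 1) / z` of `L_κ`. -/
theorem expL_invL_sub_invL (hab : ∀ j, a j < b j) {ε κ s : ℝ} (hκ : 0 < κ) (hs : 0 ≤ s)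
    {M : ℝ} {v : (Fin d → ℝ) → ℝ} (hv : EssBdd a b M v) :
    expL a b ε κ s (invL a b ε κ v) - invL a b ε κ v =ᵐ[boxMeasure a b]
      opFun a b ε κ (fun z => (Real.exp (s * z) - 1) / z) v := by
  obtain ⟨V, hV, -⟩ := hv.exists_L2
  have hneg : ∀ k, eigenvalue a b ε κ k ≤ -κ := eigenvalue_le ε κ
  have hexp : ∀ k, |Real.exp (s * eigenvalue a b ε κ k)| ≤ 1 := fun k => by
    rw [abs_of_pos (Real.exp_pos _), Real.exp_le_one_iff]
    exact mul_nonpos_of_nonneg_of_nonpos hs (by linarith [hneg k])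
  have hinv : ∀ k, |(eigenvalue a b ε κ k)⁻¹| ≤ κ⁻¹ := fun k => by
    rw [abs_inv]
    refine inv_anti₀ hκ ?_
    rw [abs_of_neg (by linarith [hneg k])]
    linarith [hneg k]
  have hexp' : ∀ k, ‖(Real.exp (s * eigenvalue a b ε κ k) : ℂ)‖ ≤ 1 := fun k => by
    rw [Complex.norm_real]
    exact hexp k
  have hinv' : ∀ k, ‖(((eigenvalue a b ε κ k)⁻¹ : ℝ) : ℂ)‖ ≤ κ⁻¹ := fun k => by
    rw [Complex.norm_real]
    exact hinv k
  have hprod : ∀ k, ‖(Real.exp (s * eigenvalue a b ε κ k) : ℂ) *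
      (((eigenvalue a b ε κ k)⁻¹ : ℝ) : ℂ)‖ ≤ 1 * κ⁻¹ := fun k => by
    rw [norm_mul]
    exact mul_le_mul (hexp' k) (hinv' k) (norm_nonneg _) zero_le_one
  have h1 : invL a b ε κ v = _ := opFun_eq_re_mulOp hab ε κ (fun z => z⁻¹) hV
  have hreal := mulOp_ofReal_eq_re hab ε κ (φ := fun z => z⁻¹) hinv hV
  have h2 : expL a b ε κ s (invL a b ε κ v) = fun x => Complex.re (mulOp (modeBasis hab)
      (fun k => (Real.exp (s * eigenvalue a b ε κ k) : ℂ)) (mulOp (modeBasis hab)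
        (fun k => (((eigenvalue a b ε κ k)⁻¹ : ℝ) : ℂ)) V) x) := by
    rw [h1]
    exact opFun_eq_re_mulOp hab ε κ (fun z => Real.exp (s * z)) hreal
  rw [h2, h1, opFun_eq_re_mulOp hab ε κ _ hV, mulOp_mul _ hexp' hinv']
  have hsub := mulOp_sub (modeBasis hab) hprod hinv' V
  have hsymb : (fun k => (Real.exp (s * eigenvalue a b ε κ k) : ℂ) *
      (((eigenvalue a b ε κ k)⁻¹ : ℝ) : ℂ) - (((eigenvalue a b ε κ k)⁻¹ : ℝ) : ℂ)) =
      fun k => (((Real.exp (s * eigenvalue a b ε κ k) - 1) / eigenvalue a b ε κ k : ℝ) : ℂ) := by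
    funext k
    push_cast
    ring
  rw [hsymb] at hsub
  rw [← hsub]
  filter_upwards [Lp.coeFn_sub (mulOp (modeBasis hab)
    (fun k => (Real.exp (s * eigenvalue a b ε κ k) : ℂ) *
      (((eigenvalue a b ε κ k)⁻¹ : ℝ) : ℂ)) V)
    (mulOp (modeBasis hab) (fun k => (((eigenvalue a b ε κ k)⁻¹ : ℝ) : ℂ)) V)] with x hx
  rw [hx, Pi.sub_apply, Pi.sub_apply, Complex.sub_re]

theorem EssBdd.expL (hab : ∀ j, a j < b j) (ε κ : ℝ) {t : ℝ} (ht : 0 ≤ t)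
    {M : ℝ} {v : (Fin d → ℝ) → ℝ} (hv : EssBdd a b M v) :
    EssBdd a b (Real.exp (-(κ * t)) * M) (expL a b ε κ t v) := by
  refine EssBdd.opFun hab (supMultiplier_heat hab ε κ ht) (Real.exp_pos _).le (fun k => ?_) hv
  rw [← Complex.ofReal_mul, ← Real.exp_add]
  congr 2
  ring

theorem EssBdd.expL_invL_sub_invL (hab : ∀ j, a j < b j) {ε κ s : ℝ} (hκ : 0 < κ) (hs : 0 ≤ s)
    {M : ℝ} {v : (Fin d → ℝ) → ℝ} (hv : EssBdd a b M v) :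
    EssBdd a b ((1 - Real.exp (-(κ * s))) / κ * M)
      (AllenCahn.expL a b ε κ s (invL a b ε κ v) - invL a b ε κ v) := by
  refine EssBdd.congr ?_ (AllenCahn.expL_invL_sub_invL hab hκ hs hv)
  rcases hs.eq_or_lt with rfl | hs
  · refine EssBdd.opFun hab SupMultiplier.one (by simp) (fun k => ?_) hv
    simp
  · have hden := one_sub_exp_neg_pos (mul_pos hκ hs)
    refine EssBdd.opFun hab (supMultiplier_duhamel hab ε hκ hs) (by positivity) (fun k => ?_) hv
    rw [← Complex.ofReal_mul]
    congr 1
    rw [← mul_assoc, div_mul_div_cancel₀ hκ.ne', div_self hden.ne', one_mul]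

/-! ### The maximum bound principle -/

section Scheme

variable {ε κ β : ℝ} {f : ℝ → ℝ} {Q : ℕ → QuadRule} {u : (Fin d → ℝ) → ℝ}

/-- Each iterate is bounded by `β`: the semigroup contributes `e^{-κ s} β`, and the integral of
`N(w)`, exact or discretized, contributes at most `(1 - e^{-κ s}) β`. -/
theorem EssBdd.stage (hab : ∀ j, a j < b j) (hκ : 0 < κ) (hβ : 0 ≤ β)
    (hf : ContDiff ℝ 1 f) (hfβ : f β ≤ 0) (hfβ' : 0 ≤ f (-β))
    (hκf : ∀ ξ ∈ Set.Icc (-β) β, |deriv f ξ| ≤ κ) (hu : EssBdd a b β u) {j : ℕ} (hj : 1 ≤ j)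
    (hQ : ∀ i, 2 ≤ i → i ≤ j → (Q i).IsGaussLegendre ∨ (Q i).IsLeftGaussRadau)
    {s : ℝ} (hs : 0 ≤ s) : EssBdd a b β (stage a b ε κ f Q u j s) := by
  induction j, hj using Nat.le_induction generalizing s with
  | base =>
    have h := (hu.expL hab ε κ hs).add
      ((hu.nonlin hf hβ hfβ hfβ' hκf).expL_invL_sub_invL hab (ε := ε) hκ hs)
    refine h.mono (le_of_eq ?_)
    field_simp
    ring
  | succ j hj ih =>
    obtain ⟨i, rfl⟩ : ∃ i, j = i + 1 := ⟨j - 1, by omega⟩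
    have hR := hQ (i + 2) (by omega) le_rfl
    have hterm : ∀ l : Fin (Q (i + 2)).m, _ := fun l =>
      have hnode := (Q (i + 2)).node_mem_of_gauss hR l
      ((((ih (fun i h2 hi => hQ i h2 (by omega)) (mul_nonneg hs hnode.1)).nonlin hf hβ hfβ hfβ'
        hκf).expL hab ε κ (t := s - s * (Q (i + 2)).node l)
          (by nlinarith [hnode.2])).const_smul
            (mul_nonneg hs ((Q (i + 2)).weight_nonneg_of_gauss hR l)))
    refine ((hu.expL hab ε κ hs).add (EssBdd.sum Finset.univ fun l _ => hterm l)).mono ?_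
    have hquad := (Q (i + 2)).sum_weight_exp_le hR hκ hs
    calc _ = Real.exp (-(κ * s)) * β + (∑ l, s * (Q (i + 2)).weight l *
          (Real.exp (-(κ * (s - s * (Q (i + 2)).node l))) * κ)) * β := by
          rw [Finset.sum_mul]
          congr 1
          exact Finset.sum_congr rfl fun l _ => by ring
      _ ≤ Real.exp (-(κ * s)) * β + (1 - Real.exp (-(κ * s))) * β := by gcongr
      _ = β := by ring

theorem EssBdd.solution (hab : ∀ j, a j < b j) (hκ : 0 < κ) (hβ : 0 ≤ β)
    (hf : ContDiff ℝ 1 f) (hfβ : f β ≤ 0) (hfβ' : 0 ≤ f (-β))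
    (hκf : ∀ ξ ∈ Set.Icc (-β) β, |deriv f ξ| ≤ κ) (hu : EssBdd a b β u) {k : ℕ} (hk : 1 ≤ k)
    (hQ : ∀ i, 2 ≤ i → i ≤ k → (Q i).IsGaussLegendre ∨ (Q i).IsLeftGaussRadau)
    {τ : ℝ} (hτ : 0 ≤ τ) (n : ℕ) : EssBdd a b β (solution a b ε κ f Q k τ u n) := by
  induction n with
  | zero => exact hu
  | succ n ih => exact ih.stage hab hκ hβ hf hfβ hfβ' hκf hk hQ hτ

end Scheme

theorem essBdd_iff_eLpNorm_le {β : ℝ} (hβ : 0 ≤ β) {v : (Fin d → ℝ) → ℝ} :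
    EssBdd a b β v ↔ MemLp v ∞ (boxMeasure a b) ∧
      eLpNorm v ∞ (boxMeasure a b) ≤ ENNReal.ofReal β := by
  constructor
  · intro h
    have hle : eLpNorm v ∞ (boxMeasure a b) ≤ ENNReal.ofReal β := by
      rw [eLpNorm_exponent_top]
      exact eLpNormEssSup_le_of_ae_bound h.2
    exact ⟨⟨h.1, hle.trans_lt ENNReal.ofReal_lt_top⟩, hle⟩
  · rintro ⟨hm, hle⟩
    refine ⟨hm.1, ?_⟩
    rw [eLpNorm_exponent_top] at hle
    filter_upwards [enorm_ae_le_eLpNormEssSup v (boxMeasure a b)] with x hx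
    have h := hx.trans hle
    rw [Real.enorm_eq_ofReal_abs] at h
    exact (ENNReal.ofReal_le_ofReal_iff hβ).1 h

end AllenCahn

theorem theorem3p1 {d : ℕ} (hd : 1 ≤ d)
    (a b : Fin d → ℝ) (hab : ∀ j, a j < b j)
    (ε κ β : ℝ) (hε : 0 < ε) (hκ : 0 < κ) (hβ : 0 < β)
    (f : ℝ → ℝ) (hf : ContDiff ℝ 1 f) (hfβ : f β ≤ 0) (hfβ' : 0 ≤ f (-β))
    (hκf : ∀ ξ ∈ Set.Icc (-β) β, |deriv f ξ| ≤ κ)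
    (k : ℕ) (hk : 1 ≤ k) (Q : ℕ → AllenCahn.QuadRule)
    (hQ : ∀ j, 2 ≤ j → j ≤ k → (Q j).IsGaussLegendre ∨ (Q j).IsLeftGaussRadau)
    (τ : ℝ) (hτ : 0 < τ)
    (u₀ : (Fin d → ℝ) → ℝ) (hu₀ : MemLp u₀ ∞ (AllenCahn.boxMeasure a b))
    (hu₀β : eLpNorm u₀ ∞ (AllenCahn.boxMeasure a b) ≤ ENNReal.ofReal β) (n : ℕ) :
    MemLp (AllenCahn.solution a b ε κ f Q k τ u₀ n) ∞ (AllenCahn.boxMeasure a b) ∧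
      eLpNorm (AllenCahn.solution a b ε κ f Q k τ u₀ n) ∞ (AllenCahn.boxMeasure a b) ≤
        ENNReal.ofReal β :=
  (AllenCahn.essBdd_iff_eLpNorm_le hβ.le).1
    (((AllenCahn.essBdd_iff_eLpNorm_le hβ.le).2 ⟨hu₀, hu₀β⟩).solution hab hκ hβ.le hf hfβ hfβ' hκf
      hk hQ hτ.le n)
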